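/- Let $X$ be a finite set and let $\mathcal R\subseteq X\times X$ be a tolerance relation, i.e. a reflexive and symmetric relation. Let $G(\mathcal R)$ be the graph on $X$ in which distinct $x,y$ are adjacent if and only if $(x,y)\in\mathcal R$, and suppose that $G(\mathcal R)$ is chordal: every cycle of length at least $4$ has a chord. Let $\mathcal C$ be the set of maximal cliques of $G(\mathcal R)$, and let $$E(\mathcal R)=\{(x_{ij})\in M_X(\mathbb C)\mid x_{ij}=0\text{ if }(i,j)\notin\mathcal R\}$$ be the associated operator system, with $M_n(E(\mathcal R))_+=M_n(E(\mathcal R))\cap M_n(M_X(\mathbb C))_+$. Let $E(\mathcal R)^d$ be its dual space with the involution $\varphi^*(x)=\overline{\varphi(x^*)}$ and the dual matrix order: $M_n(E(\mathcal R)^d)_+$ consists of the hermitian matrices $(\varphi_{kl})$ with $\sum_{k,l}\varphi_{kl}(x_{kl})\ge 0$ for all $(x_{kl})\in M_n(E(\mathcal R))_+$. Identify $E(\mathcal R)^d$ with $E(\mathcal R)$ as a vector space by sending $\varphi$ to the matrix in $E(\mathcal R)$ with entries $\varphi(e_{ij})$ for $(i,j)\in\mathcal R$, where $e_{ij}$ are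 the matrix units. Then the linear map $$\Phi:E(\mathcal R)^d\to\bigoplus_{C\in\mathcal C}M_{|C|}(\mathbb C),\qquad (x_{ij})\mapsto\big((x_{ij})_{i,j\in C}\big)_{C\in\mathcal C}$$ is a complete order embedding: it is injective and completely positive, and its inverse on the image, with the matrix order induced from the $C^*$-algebra $\bigoplus_{C\in\mathcal C}M_{|C|}(\mathbb C)$, is completely positive. Moreover, under the identification, the positive cone $E(\mathcal R)^d_+$ consists exactly of those $(x_{ij})\in E(\mathcal R)$ that are partially positive, i.e. for which the principal submatrix $(x_{ij})_{i,j\in C}$ is positive semidefinite for every clique $C$ of $G(\mathcal R)$. -/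

import Mathlib

noncomputable section

open scoped Matrix ComplexOrder

namespace FiniteTolerance

/-! ### Matrix ordered `*`-vector spaces -/

/-- The matrix `N x N*` over a vector space `V`, for a scalar matrix `N` and a matrix `x` with
entries in `V`. -/
def scalarConj {V : Type*} [AddCommGroup V] [Module ℂ V] {m n : ℕ}
    (N : Matrix (Fin m) (Fin n) ℂ) (x : Matrix (Fin n) (Fin n) V) : Matrix (Fin m) (Fin m) V :=
  Matrix.of fun i j => ∑ k, ∑ l, (N i k * star (N j l)) • x k l

/-- A matrix ordered `*`-vector space: for every `n` a proper convex cone of hermitian elements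
in `M_n(V)`, such that `N M_n(V)₊ N* ⊆ M_m(V)₊` for every scalar `m × n` matrix `N`. -/
class MatrixOrdered (V : Type*) [AddCommGroup V] [StarAddMonoid V] [Module ℂ V]
    [StarModule ℂ V] where
  /-- the cone `M_n(V)₊` -/
  cone : ∀ n : ℕ, Set (Matrix (Fin n) (Fin n) V)
  isHermitian : ∀ {n : ℕ} {x : Matrix (Fin n) (Fin n) V}, x ∈ cone n → x.IsHermitian
  zero_mem : ∀ n : ℕ, 0 ∈ cone n
  add_mem : ∀ {n : ℕ} {x y : Matrix (Fin n) (Fin n) V},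
    x ∈ cone n → y ∈ cone n → x + y ∈ cone n
  smul_mem : ∀ {n : ℕ} {c : ℝ} {x : Matrix (Fin n) (Fin n) V},
    0 ≤ c → x ∈ cone n → (c : ℂ) • x ∈ cone n
  proper : ∀ {n : ℕ} {x : Matrix (Fin n) (Fin n) V}, x ∈ cone n → -x ∈ cone n → x = 0
  conj_mem : ∀ {m n : ℕ} (N : Matrix (Fin m) (Fin n) ℂ) {x : Matrix (Fin n) (Fin n) V},
    x ∈ cone n → scalarConj N x ∈ cone m

/-- The cone `V₊` of positive elements of a matrix ordered space, i.e. `M_1(V)₊`. -/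
def posCone (V : Type*) [AddCommGroup V] [StarAddMonoid V] [Module ℂ V]
    [StarModule ℂ V] [MatrixOrdered V] : Set V :=
  {v | (Matrix.of fun _ _ => v : Matrix (Fin 1) (Fin 1) V) ∈ MatrixOrdered.cone 1}

section Maps

variable {V W : Type*} [AddCommGroup V] [StarAddMonoid V] [Module ℂ V] [StarModule ℂ V]
  [MatrixOrdered V] [AddCommGroup W] [StarAddMonoid W] [Module ℂ W] [StarModule ℂ W]
  [MatrixOrdered W]

/-- `f` is completely positive: all entrywise maps `M_n(V) → M_n(W)` are positive. -/
def IsCompletelyPositive (f : V →ₗ[ℂ] W) : Prop :=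
  ∀ n : ℕ, ∀ x ∈ MatrixOrdered.cone (V := V) n, x.map f ∈ MatrixOrdered.cone (V := W) n

/-- `f` is a complete order embedding, i.e. a complete order isomorphism onto its image, where the
image carries the cones induced from `W`: it is injective and completely positive, and so is its
inverse on the image. -/
structure IsCompleteOrderEmbedding (f : V →ₗ[ℂ] W) : Prop where
  injective : Function.Injective f
  completelyPositive : IsCompletelyPositive f
  inverse_completelyPositive : ∀ (n : ℕ) (x : Matrix (Fin n) (Fin n) V),
    x.map f ∈ MatrixOrdered.cone (V := W) n → x ∈ MatrixOrdered.cone (V := V) n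

end Maps

/-! ### Finite-dimensional C*-algebras -/

/-- The positive elements `b* b` of the `*`-algebra `M_n(A)`. -/
def starCone (A : Type*) [Ring A] [StarRing A] (n : ℕ) : Set (Matrix (Fin n) (Fin n) A) :=
  {a | ∃ b : Matrix (Fin n) (Fin n) A, a = bᴴ * b}

section MatrixAlgebra

variable {ι : Type*} [Fintype ι] [DecidableEq ι]

open scoped MatrixOrder in
/-- Under `M_n(M_ι(ℂ)) ≅ M_{n × ι}(ℂ)` positive elements are positive semidefinite matrices. -/
theorem mem_starCone_matrix {n : ℕ} {a : Matrix (Fin n) (Fin n) (Matrix ι ι ℂ)} :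
    a ∈ starCone (Matrix ι ι ℂ) n ↔ (Matrix.comp _ _ _ _ _ a).PosSemidef := by
  have key : ∀ b : Matrix (Fin n) (Fin n) (Matrix ι ι ℂ),
      Matrix.comp _ _ _ _ _ (bᴴ * b)
        = (Matrix.comp _ _ _ _ _ b)ᴴ * Matrix.comp _ _ _ _ _ b := fun b =>
    map_mul (Matrix.compRingEquiv (Fin n) ι ℂ) bᴴ b
  constructor
  · rintro ⟨b, rfl⟩
    rw [key]
    exact Matrix.posSemidef_conjTranspose_mul_self _
  · intro h
    obtain ⟨c, hc⟩ : ∃ c : Matrix (Fin n × ι) (Fin n × ι) ℂ,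
        Matrix.comp _ _ _ _ _ a = cᴴ * c :=
      (CStarAlgebra.nonneg_iff_eq_star_mul_self).1 h.nonneg
    refine ⟨(Matrix.comp _ _ _ _ _).symm c, (Matrix.comp _ _ _ _ _).injective ?_⟩
    rw [key, hc, Equiv.apply_symm_apply]

theorem starCone_isHermitian {A : Type*} [Ring A] [StarRing A] {n : ℕ}
    {a : Matrix (Fin n) (Fin n) A} (h : a ∈ starCone A n) : a.IsHermitian := by
  obtain ⟨b, rfl⟩ := h
  exact Matrix.isHermitian_conjTranspose_mul_self b

theorem starCone_zero_mem (A : Type*) [Ring A] [StarRing A] (n : ℕ) : 0 ∈ starCone A n :=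
  ⟨0, by simp⟩

theorem starCone_add_mem {n : ℕ} {a b : Matrix (Fin n) (Fin n) (Matrix ι ι ℂ)}
    (ha : a ∈ starCone (Matrix ι ι ℂ) n) (hb : b ∈ starCone (Matrix ι ι ℂ) n) :
    a + b ∈ starCone (Matrix ι ι ℂ) n := by
  rw [mem_starCone_matrix] at *
  exact ha.add hb

theorem starCone_smul_mem {n : ℕ} {c : ℝ} {a : Matrix (Fin n) (Fin n) (Matrix ι ι ℂ)}
    (hc : 0 ≤ c) (ha : a ∈ starCone (Matrix ι ι ℂ) n) :
    (c : ℂ) • a ∈ starCone (Matrix ι ι ℂ) n := by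
  rw [mem_starCone_matrix] at *
  exact ha.smul (a := (c : ℂ)) (by exact_mod_cast hc)

open scoped MatrixOrder in
theorem starCone_proper {n : ℕ} {a : Matrix (Fin n) (Fin n) (Matrix ι ι ℂ)}
    (ha : a ∈ starCone (Matrix ι ι ℂ) n) (hb : -a ∈ starCone (Matrix ι ι ℂ) n) : a = 0 := by
  rw [mem_starCone_matrix] at *
  apply (Matrix.comp _ _ _ _ _).injective
  exact le_antisymm (neg_nonneg.1 (Matrix.nonneg_iff_posSemidef.2 hb))
    (Matrix.nonneg_iff_posSemidef.2 ha)

theorem starCone_conj_mem {m n : ℕ} (N : Matrix (Fin m) (Fin n) ℂ)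
    {a : Matrix (Fin n) (Fin n) (Matrix ι ι ℂ)} (ha : a ∈ starCone (Matrix ι ι ℂ) n) :
    scalarConj N a ∈ starCone (Matrix ι ι ℂ) m := by
  rw [mem_starCone_matrix] at *
  have h := ha.mul_mul_conjTranspose_same
    (Matrix.of fun (p : Fin m × ι) (q : Fin n × ι) => if p.2 = q.2 then N p.1 q.1 else 0)
  convert h using 1
  ext ⟨i, x⟩ ⟨j, y⟩
  simp only [scalarConj, Matrix.comp_apply, Matrix.of_apply, Matrix.mul_apply,
    Matrix.conjTranspose_apply, Fintype.sum_prod_type, Matrix.sum_apply, Matrix.smul_apply]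
  simp only [ite_mul, zero_mul, Finset.sum_ite_eq, Finset.mem_univ, if_true, apply_ite star,
    star_zero, mul_ite, mul_zero, Finset.sum_mul]
  rw [Finset.sum_comm]
  refine Finset.sum_congr rfl fun l _ => Finset.sum_congr rfl fun k _ => ?_
  simp only [smul_eq_mul]
  ring

end MatrixAlgebra

section DirectSum

variable {I : Type*} {ι : I → Type*} [∀ i, Fintype (ι i)] [∀ i, DecidableEq (ι i)]

theorem mem_starCone_pi {n : ℕ} {a : Matrix (Fin n) (Fin n) (∀ i, Matrix (ι i) (ι i) ℂ)} :
    a ∈ starCone (∀ i, Matrix (ι i) (ι i) ℂ) n ↔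
      ∀ i, a.map (fun f => f i) ∈ starCone (Matrix (ι i) (ι i) ℂ) n := by
  constructor
  · rintro ⟨b, rfl⟩ i
    refine ⟨b.map fun f => f i, ?_⟩
    ext1 k l
    simp [Matrix.mul_apply, Finset.sum_apply]
  · intro h
    choose b hb using h
    refine ⟨Matrix.of fun k l i => b i k l, ?_⟩
    ext1 k l
    funext i
    have := congrFun (congrFun (hb i) k) l
    simpa [Matrix.mul_apply, Finset.sum_apply] using this

/-- The matrix order of the C*-algebra `⨁ i, M_{ι i}(ℂ)`: the positive elements of `M_n` of it
are those of the form `b* b`. -/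
instance directSumMatrixOrdered : MatrixOrdered (∀ i, Matrix (ι i) (ι i) ℂ) where
  cone := starCone _
  isHermitian := starCone_isHermitian
  zero_mem := starCone_zero_mem _
  add_mem := fun ha hb => mem_starCone_pi.2 fun i =>
    starCone_add_mem (mem_starCone_pi.1 ha i) (mem_starCone_pi.1 hb i)
  smul_mem := fun hc ha => mem_starCone_pi.2 fun i =>
    starCone_smul_mem hc (mem_starCone_pi.1 ha i)
  proper := fun {n x} ha hb => by
    have h : ∀ i, x.map (fun f => f i) = 0 := fun i =>
      starCone_proper (mem_starCone_pi.1 ha i) (mem_starCone_pi.1 hb i)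
    ext1 k l
    funext i
    exact congrFun (congrFun (h i) k) l
  conj_mem := fun {m n} N x ha => mem_starCone_pi.2 fun i => by
    have h := starCone_conj_mem N (mem_starCone_pi.1 ha i)
    convert h using 1
    ext1 k l
    simp [scalarConj, Finset.sum_apply]

end DirectSum

/-! ### Duals -/

section Dual

/-- The identification of `M_n(V^d)` with `M_n(V)^d`: the matrix `(φ_ij)` acts on `M_n(V)` by
`(x_ij) ↦ ∑ φ_ij(x_ij)`. -/
def matrixPairing {V : Type*} [AddCommGroup V] [Module ℂ V] {n : ℕ} (φ : Matrix (Fin n) (Fin n) (Module.Dual ℂ V)) :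
    Module.Dual ℂ (Matrix (Fin n) (Fin n) V) where
  toFun x := ∑ i, ∑ j, φ i j (x i j)
  map_add' x y := by simp [Finset.sum_add_distrib]
  map_smul' c x := by simp [Finset.mul_sum]

theorem matrixPairing_scalarConj {V : Type*} [AddCommGroup V] [Module ℂ V] {m n : ℕ} (N : Matrix (Fin m) (Fin n) ℂ)
    (φ : Matrix (Fin n) (Fin n) (Module.Dual ℂ V)) (x : Matrix (Fin m) (Fin m) V) :
    matrixPairing (scalarConj N φ) x = matrixPairing φ (scalarConj Nᵀ x) := by
  simp only [matrixPairing, scalarConj, LinearMap.coe_mk, AddHom.coe_mk, Matrix.of_apply,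
    LinearMap.sum_apply, LinearMap.smul_apply, map_sum, map_smul, Matrix.transpose_apply]
  calc _ = ∑ i, ∑ k, ∑ j, ∑ l, (N i k * star (N j l)) • (φ k l) (x i j) :=
        Finset.sum_congr rfl fun i _ => Finset.sum_comm
    _ = ∑ k, ∑ i, ∑ j, ∑ l, (N i k * star (N j l)) • (φ k l) (x i j) := Finset.sum_comm
    _ = ∑ k, ∑ i, ∑ l, ∑ j, (N i k * star (N j l)) • (φ k l) (x i j) :=
        Finset.sum_congr rfl fun k _ => Finset.sum_congr rfl fun i _ => Finset.sum_comm
    _ = _ := Finset.sum_congr rfl fun k _ => Finset.sum_comm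

variable {V : Type*} [AddCommGroup V] [StarAddMonoid V] [Module ℂ V] [StarModule ℂ V]

/-- The involution `φ*(x) = conj (φ (x*))` on the dual space. -/
instance dualStar : Star (Module.Dual ℂ V) where
  star φ :=
    { toFun := fun x => star (φ (star x))
      map_add' := fun x y => by simp
      map_smul' := fun c x => by simp }

@[simp] theorem dual_star_apply (φ : Module.Dual ℂ V) (x : V) :
    (star φ) x = star (φ (star x)) := rfl

instance dualStarAddMonoid : StarAddMonoid (Module.Dual ℂ V) where
  star_involutive := fun φ => by ext x; simp
  star_add := fun φ ψ => by ext x; simp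

instance dualStarModule : StarModule ℂ (Module.Dual ℂ V) where
  star_smul := fun c φ => by ext x; simp

/-- The cone of all hermitian elements of `M_n(V^d) ≅ M_n(V)^d` that are nonnegative
on `M_n(V)₊`. -/
def dualCone (V : Type*) [AddCommGroup V] [StarAddMonoid V] [Module ℂ V] [StarModule ℂ V]
    [MatrixOrdered V] (n : ℕ) : Set (Matrix (Fin n) (Fin n) (Module.Dual ℂ V)) :=
  {φ | φ.IsHermitian ∧ ∀ x ∈ MatrixOrdered.cone (V := V) n, 0 ≤ matrixPairing φ x}

theorem scalarConj_isHermitian {m n : ℕ} (N : Matrix (Fin m) (Fin n) ℂ)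
    {x : Matrix (Fin n) (Fin n) V} (hx : x.IsHermitian) : (scalarConj N x).IsHermitian := by
  ext1 i j
  simp only [scalarConj, Matrix.conjTranspose_apply, Matrix.of_apply, star_sum, star_smul]
  rw [Finset.sum_comm]
  refine Finset.sum_congr rfl fun k _ => Finset.sum_congr rfl fun l _ => ?_
  rw [hx.apply]
  simp [mul_comm]

/-- The dual matrix order satisfies the axioms, provided that `M_n(V)₊` spans enough for a
functional that vanishes on it to vanish. -/
@[reducible] def dualMatrixOrdered (V : Type*) [AddCommGroup V] [StarAddMonoid V] [Module ℂ V]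
    [StarModule ℂ V] [MatrixOrdered V]
    (hV : ∀ (n : ℕ) (φ : Matrix (Fin n) (Fin n) (Module.Dual ℂ V)),
      (∀ x ∈ MatrixOrdered.cone (V := V) n, matrixPairing φ x = 0) → φ = 0) :
    MatrixOrdered (Module.Dual ℂ V) where
  cone := dualCone V
  isHermitian := fun h => h.1
  zero_mem := fun n => ⟨Matrix.isHermitian_zero, fun x _ => by simp [matrixPairing]⟩
  add_mem := fun {n φ ψ} hφ hψ => ⟨hφ.1.add hψ.1, fun x hx => by
    have : matrixPairing (φ + ψ) x = matrixPairing φ x + matrixPairing ψ x := by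
      simp [matrixPairing, Finset.sum_add_distrib]
    rw [this]
    exact add_nonneg (hφ.2 x hx) (hψ.2 x hx)⟩
  smul_mem := fun {n c φ} hc hφ => ⟨by
      ext1 i j
      simp [Matrix.conjTranspose_apply, star_smul, hφ.1.apply i j], fun x hx => by
    have : matrixPairing ((c : ℂ) • φ) x = (c : ℂ) * matrixPairing φ x := by
      simp [matrixPairing, Finset.mul_sum]
    rw [this]
    exact mul_nonneg (by exact_mod_cast hc) (hφ.2 x hx)⟩
  proper := fun {n φ} h₁ h₂ => hV n φ fun x hx => by
    have : matrixPairing (-φ) x = -matrixPairing φ x := by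
      simp [matrixPairing]
    have h := h₂.2 x hx
    rw [this] at h
    exact le_antisymm (neg_nonneg.1 h) (h₁.2 x hx)
  conj_mem := fun N φ hφ => ⟨scalarConj_isHermitian N hφ.1, fun x hx => by
    rw [matrixPairing_scalarConj]
    exact hφ.2 _ (MatrixOrdered.conj_mem _ hx)⟩

end Dual

/-! ### The operator system of a tolerance relation -/

/-- A tolerance relation: a reflexive and symmetric relation. -/
structure ToleranceRelation (X : Type*) where
  /-- the relation -/
  rel : X → X → Prop
  refl : ∀ x, rel x x
  symm : ∀ x y, rel x y → rel y x

section System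

variable {X : Type*} (R : ToleranceRelation X)

/-- The graph of a tolerance relation: edges join distinct related points. -/
def ToleranceRelation.graph : SimpleGraph X where
  Adj x y := x ≠ y ∧ R.rel x y
  symm := ⟨fun _ _ h => ⟨h.1.symm, R.symm _ _ h.2⟩⟩
  loopless := ⟨fun _ h => h.1 rfl⟩

/-- The operator system `E(R)` of all complex matrices supported on `R`. -/
def ToleranceRelation.system : Submodule ℂ (Matrix X X ℂ) where
  carrier := {x | ∀ i j, ¬ R.rel i j → x i j = 0}
  zero_mem' := fun _ _ _ => rfl
  add_mem' := fun {x y} hx hy i j h => by simp [hx i j h, hy i j h]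
  smul_mem' := fun c x hx i j h => by simp [hx i j h]

instance systemStar : Star R.system where
  star x := ⟨(x : Matrix X X ℂ)ᴴ, fun i j h => by
    rw [Matrix.conjTranspose_apply, x.2 j i fun h' => h (R.symm _ _ h'), star_zero]⟩

@[simp] theorem coe_system_star (x : R.system) :
    ((star x : R.system) : Matrix X X ℂ) = (x : Matrix X X ℂ)ᴴ := rfl

instance systemStarAddMonoid : StarAddMonoid R.system where
  star_involutive := fun x => Subtype.ext (by simp)
  star_add := fun x y => Subtype.ext (by simp)

instance systemStarModule : StarModule ℂ R.system where
  star_smul := fun c x => Subtype.ext (by simp)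

variable [Fintype X] [DecidableEq X]

/-- The matrix order of `E(R)` as a subspace of the C*-algebra `M_X(ℂ)`: the cone `M_n(E(R))₊`
consists of the positive elements of `M_n(M_X(ℂ))` that have entries in `E(R)`. -/
instance systemMatrixOrdered : MatrixOrdered R.system where
  cone n := {x | x.map (fun e => (e : Matrix X X ℂ)) ∈ starCone (Matrix X X ℂ) n}
  isHermitian := fun {n x} h => by
    ext1 i j
    apply Subtype.ext
    have := (starCone_isHermitian h).apply i j
    simpa [Matrix.star_eq_conjTranspose] using this
  zero_mem := fun n => by
    have h := starCone_zero_mem (Matrix X X ℂ) n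
    rwa [← Matrix.map_zero (fun e : R.system => (e : Matrix X X ℂ)) rfl] at h
  add_mem := fun hx hy => starCone_add_mem hx hy
  smul_mem := fun hc hx => starCone_smul_mem hc hx
  proper := fun {n x} h₁ h₂ => by
    have h := starCone_proper h₁ h₂
    ext1 i j
    exact Subtype.ext (congrFun (congrFun h i) j)
  conj_mem := fun {m n} N x hx => by
    have h := starCone_conj_mem N hx
    show (scalarConj N x).map (fun e => (e : Matrix X X ℂ)) ∈ starCone (Matrix X X ℂ) m
    convert h using 1
    ext1 i j
    simp [scalarConj]

/-- The matrix unit `e_ij`, an element of `E(R)` if `(i, j)` lies in `R`. -/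
def ToleranceRelation.unit {i j : X} (h : R.rel i j) : R.system :=
  ⟨Matrix.single i j 1, fun k l hkl => by
    rw [Matrix.single_apply, if_neg]
    rintro ⟨rfl, rfl⟩
    exact hkl h⟩

open Classical in
theorem system_eq_sum (x : R.system) :
    x = ∑ i, ∑ j, if h : R.rel i j then (x : Matrix X X ℂ) i j • R.unit h else 0 := by
  apply Subtype.ext
  ext k l
  have : ∀ i j, ((if h : R.rel i j then (x : Matrix X X ℂ) i j • R.unit h else 0 : R.system) :
      Matrix X X ℂ) = Matrix.single i j ((x : Matrix X X ℂ) i j) := by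
    intro i j
    split_ifs with h
    · simp [ToleranceRelation.unit]
    · simp [x.2 i j h]
  simp only [AddSubmonoidClass.coe_finsetSum, this]
  rw [← Matrix.matrix_eq_sum_single]

theorem system_dual_ext {φ ψ : Module.Dual ℂ R.system}
    (h : ∀ i j (hij : R.rel i j), φ (R.unit hij) = ψ (R.unit hij)) : φ = ψ := by
  classical
  ext x
  rw [system_eq_sum R x]
  simp only [map_sum]
  refine Finset.sum_congr rfl fun i _ => Finset.sum_congr rfl fun j _ => ?_
  split_ifs with hij
  · simp [h i j hij]
  · simp

theorem system_separating (n : ℕ) (φ : Matrix (Fin n) (Fin n) (Module.Dual ℂ R.system))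
    (hφ : ∀ x ∈ MatrixOrdered.cone (V := R.system) n, matrixPairing φ x = 0) : φ = 0 := by
  have pair : ∀ (k l : Fin n) (v : R.system), matrixPairing φ (Matrix.single k l v) = φ k l v := by
    intro k l v
    show ∑ a, ∑ b, φ a b (Matrix.single k l v a b) = _
    rw [Finset.sum_eq_single k, Finset.sum_eq_single l]
    · simp
    · intro b _ hb
      simp [hb.symm]
    · simp
    · intro a _ ha
      exact Finset.sum_eq_zero fun b _ => by simp [ha.symm]
    · simp
  ext1 k l
  refine system_dual_ext R fun i j hij => ?_
  have main : ∀ z : ℂ, star z * z = 1 →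
      φ k k (R.unit (R.refl i)) + z * φ k l (R.unit hij)
        + star z * φ l k (R.unit (R.symm _ _ hij)) + φ l l (R.unit (R.refl j)) = 0 := by
    intro z hz
    have hx := hφ (Matrix.single k k (R.unit (R.refl i)) + z • Matrix.single k l (R.unit hij)
      + star z • Matrix.single l k (R.unit (R.symm _ _ hij))
      + Matrix.single l l (R.unit (R.refl j))) ?_
    · simpa only [map_add, map_smul, pair, smul_eq_mul] using hx
    · let b : Matrix (Fin n) (Fin n) (Matrix X X ℂ) :=
        Matrix.single k k (Matrix.single i i 1) + Matrix.single k l (Matrix.single i j z)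
      refine ⟨b, ?_⟩
      have hb : bᴴ * b = Matrix.single k k (Matrix.single i i 1)
          + Matrix.single k l (Matrix.single i j z)
          + (Matrix.single l k (Matrix.single j i (star z))
          + Matrix.single l l (Matrix.single j j 1)) := by
        simp only [b, Matrix.conjTranspose_add, Matrix.conjTranspose_single,
          Matrix.star_eq_conjTranspose, add_mul, mul_add, Matrix.single_mul_single_same,
          star_one, one_mul, mul_one, hz]
        abel
      rw [hb]
      have coe : ∀ (k l : Fin n) (v : R.system),
          (Matrix.single k l v).map (fun e => (e : Matrix X X ℂ))
            = Matrix.single k l (v : Matrix X X ℂ) := fun k l v =>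
        Matrix.map_single _ _ _ R.system.subtype
      have hadd : ∀ x y : Matrix (Fin n) (Fin n) R.system,
          (x + y).map (fun e => (e : Matrix X X ℂ))
            = x.map (fun e => (e : Matrix X X ℂ)) + y.map (fun e => (e : Matrix X X ℂ)) :=
        fun _ _ => rfl
      simp only [hadd, coe, Matrix.smul_single, Submodule.coe_smul, ToleranceRelation.unit,
        smul_eq_mul, mul_one, add_assoc]
  have h1 := main 1 (by simp)
  have h2 := main (-1) (by simp)
  have h3 := main Complex.I (by simp)
  have h4 := main (-Complex.I) (by simp)
  simp only [star_one, star_neg, Complex.star_def, Complex.conj_I] at h1 h2 h3 h4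
  show φ k l (R.unit hij) = 0
  linear_combination (h1 - h2) / 4 - Complex.I * (h3 - h4) / 4
    + (φ k l (R.unit hij) - φ l k (R.unit (R.symm _ _ hij))) * Complex.I_mul_I / 2

/-- The dual operator system `E(R)^d`. -/
instance systemDualMatrixOrdered : MatrixOrdered (Module.Dual ℂ R.system) :=
  dualMatrixOrdered R.system (system_separating R)

open Classical in
/-- The identification of `E(R)^d` with `E(R)` that sends a functional `φ` to the
matrix with entries `φ(e_ij)`; a matrix `x` in `E(R)` acts on `E(R)` by `y ↦ ∑ x_ij y_ij`. -/
def ToleranceRelation.dualEquiv : Module.Dual ℂ R.system ≃ₗ[ℂ] R.system where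
  toFun φ := ⟨Matrix.of fun i j => if h : R.rel i j then φ (R.unit h) else 0,
    fun i j h => by simp [h]⟩
  map_add' φ ψ := Subtype.ext <| by
    ext i j
    by_cases h : R.rel i j <;> simp [h]
  map_smul' c φ := Subtype.ext <| by
    ext i j
    by_cases h : R.rel i j <;> simp [h]
  invFun x :=
    { toFun := fun y => ∑ i, ∑ j, (x : Matrix X X ℂ) i j * (y : Matrix X X ℂ) i j
      map_add' := fun y z => by simp [mul_add, Finset.sum_add_distrib]
      map_smul' := fun c y => by simp [Finset.mul_sum, mul_left_comm] }
  left_inv φ := system_dual_ext R fun k l hkl => by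
    simp only [LinearMap.coe_mk, AddHom.coe_mk, ToleranceRelation.unit, Matrix.single_apply,
      Matrix.of_apply, mul_ite, mul_one, mul_zero, ite_and]
    simp [hkl]
  right_inv x := Subtype.ext <| by
    ext k l
    by_cases hkl : R.rel k l
    · simp [hkl, ToleranceRelation.unit, Matrix.single_apply, ite_and]
    · simp [hkl, x.2 k l hkl]

/-- The maximal cliques of the graph of `R`. -/
abbrev ToleranceRelation.MaxClique : Type _ :=
  {C : Finset X // Maximal (fun D : Finset X => R.graph.IsClique (D : Set X)) C}

/-- The map `E(R) → ⨁_C M_C(ℂ)` that sends a matrix to the tuple of its principal submatrices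
indexed by the maximal cliques `C`. -/
def ToleranceRelation.restrictMaxCliques :
    R.system →ₗ[ℂ] (∀ C : R.MaxClique, Matrix (C : Finset X) (C : Finset X) ℂ) where
  toFun x _ := (x : Matrix X X ℂ).submatrix (fun i => (i : X)) (fun i => (i : X))
  map_add' _ _ := rfl
  map_smul' _ _ := rfl

/-- The map `Φ : E(R)^d → ⨁_C M_C(ℂ)`, where `E(R)^d` is identified with `E(R)`. -/
def ToleranceRelation.Phi :
    Module.Dual ℂ R.system →ₗ[ℂ]
      (∀ C : R.MaxClique, Matrix (C : Finset X) (C : Finset X) ℂ) :=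
  R.restrictMaxCliques ∘ₗ (R.dualEquiv : Module.Dual ℂ R.system →ₗ[ℂ] R.system)

end System

/-! ### Chordal graphs and partial matrices -/

/-- A graph is chordal if every cycle of length at least `4` has a chord: an edge of the graph
that joins two vertices of the cycle and is not an edge of the cycle. -/
def IsChordal {X : Type*} (G : SimpleGraph X) : Prop :=
  ∀ (v : X) (c : G.Walk v v), c.IsCycle → 4 ≤ c.length →
    ∃ x ∈ c.support, ∃ y ∈ c.support, G.Adj x y ∧ s(x, y) ∉ c.edges

/-- The partial matrix with graph `G`, whose specified entries are the diagonal entries and the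
entries `M i j` at the edges of `G`, is partially positive: every fully specified principal
submatrix is positive semidefinite. -/
def IsPartiallyPositive {X : Type*} (G : SimpleGraph X) (M : Matrix X X ℂ) : Prop :=
  ∀ C : Set X, G.IsClique C →
    (M.submatrix (fun i : C => (i : X)) (fun i : C => (i : X))).PosSemidef

end FiniteTolerance

end

noncomputable section

open scoped Matrix ComplexOrder

namespace FiniteTolerance

/-! ### Simplicial vertices of chordal graphs -/

section Chordal

variable {X : Type*}

/-! Encode a matrix of functionals by its coefficient matrix `B` over `Fin n × X`. Pairing it with
`x` in `M_n(E(R))₊` gives `∑ B p q * A p q`, where `A` is a positive semidefinite matrix supported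
on the relation. Both positivity of the functional and positivity of its image under `Φ` are
compared with one intermediate condition, `NonnegOnCliques`: `B` is nonnegative on the matrices `w
w*` whose support projects to a clique of `X`.

Such `w w*` lie in `M_n(E(R))₊`, so dual positivity implies this condition, which for hermitian `B`
forces every clique block to be positive semidefinite. Conversely, positive blocks at the maximal
cliques give the condition. None of this uses chordality.

Chordality is needed to return from the condition to the dual cone: every admissible `A` must be a
sum of such `w w*`. By Dirac's theorem some vertex is simplicial. Gaussian elimination at it splits
off a rank one matrix supported on a clique and leaves a Schur complement that is positive
semidefinite, with no entries outside the relation. `NonnegOnCliques.sum_nonneg_of_support` runs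
this induction directly on the inequality. -/

/-- The graph on `X` whose edges are the edges of `G` with both ends in `S`. -/
def restrictEdges (G : SimpleGraph X) (S : Set X) : SimpleGraph X where
  Adj u v := G.Adj u v ∧ u ∈ S ∧ v ∈ S
  symm := ⟨fun _ _ h => ⟨h.1.symm, h.2.2, h.2.1⟩⟩
  loopless := ⟨fun _ h => h.1.ne rfl⟩

theorem restrictEdges_le (G : SimpleGraph X) (S : Set X) : restrictEdges G S ≤ G :=
  fun _ _ h => h.1

theorem restrictEdges_mono (G : SimpleGraph X) {S T : Set X} (h : S ⊆ T) :
    restrictEdges G S ≤ restrictEdges G T :=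
  fun _ _ h' => ⟨h'.1, h h'.2.1, h h'.2.2⟩

theorem mem_of_mem_support_restrictEdges {G : SimpleGraph X} {S : Set X} {a b : X}
    (p : (restrictEdges G S).Walk a b) (ha : a ∈ S) : ∀ z ∈ p.support, z ∈ S := by
  induction p with
  | nil => simpa using ha
  | cons h p ih =>
    intro z hz
    rw [SimpleGraph.Walk.support_cons, List.mem_cons] at hz
    rcases hz with rfl | hz
    · exact ha
    · exact ih h.2.2 z hz

theorem mem_of_reachable_restrictEdges {G : SimpleGraph X} {S : Set X} {a b : X}
    (h : (restrictEdges G S).Reachable a b) (ha : a ∈ S) : b ∈ S := by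
  obtain ⟨p⟩ := h
  exact mem_of_mem_support_restrictEdges p ha b p.end_mem_support

/-- An edge that joins two vertices of a shortest walk belongs to the walk. -/
theorem mem_edges_of_length_eq_dist {H : SimpleGraph X} {a b : X} (p : H.Walk a b)
    (hp : p.length = H.dist a b) {x y : X} (hx : x ∈ p.support) (hy : y ∈ p.support)
    (hxy : H.Adj x y) : s(x, y) ∈ p.edges := by
  have key : ∀ i j, i < j → j ≤ p.length → H.Adj (p.getVert i) (p.getVert j) →
      s(p.getVert i, p.getVert j) ∈ p.edges := by
    intro i j hij hj h
    -- Taking the edge as a shortcut from position `i` to `j` cannot shorten a geodesic, so `j = i +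
    -- 1`.
    have hlen := SimpleGraph.dist_le ((p.take i).append (SimpleGraph.Walk.cons h (p.drop j)))
    rw [SimpleGraph.Walk.length_append, SimpleGraph.Walk.length_cons,
      SimpleGraph.Walk.drop_length, SimpleGraph.Walk.take_length, ← hp] at hlen
    obtain rfl : j = i + 1 := by omega
    exact (p.mk_mem_edges_iff_exists).2 ⟨i, by omega, rfl⟩
  obtain ⟨i, rfl, hi⟩ := SimpleGraph.Walk.mem_support_iff_exists_getVert.1 hx
  obtain ⟨j, rfl, hj⟩ := SimpleGraph.Walk.mem_support_iff_exists_getVert.1 hy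
  rcases lt_trichotomy i j with h | rfl | h
  · exact key i j h hj hxy
  · exact absurd rfl hxy.ne
  · rw [Sym2.eq_swap]
    exact key j i h hi hxy.symm

/-- In a chordal graph, two neighbours of `x` that are connected by a path through
non-neighbours of `x` are adjacent. -/
theorem IsChordal.adj_of_reachable {G : SimpleGraph X} (hG : IsChordal G) {x a b : X}
    {W : Set X} (hxW : x ∉ W) (hW : ∀ z ∈ W, ¬ G.Adj x z) (ha : G.Adj x a) (hb : G.Adj x b)
    (hab : a ≠ b) (h : (restrictEdges G (W ∪ {a, b})).Reachable a b) : G.Adj a b := by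
  by_contra hnadj
  set S : Set X := W ∪ {a, b} with hS
  have haS : a ∈ S := by simp [hS]
  have hbS : b ∈ S := by simp [hS]
  have hxS : x ∉ S := by
    rintro (h | rfl | rfl)
    · exact hxW h
    · exact ha.ne rfl
    · exact hb.ne rfl
  have hxadj : ∀ z ∈ S, G.Adj x z → z = a ∨ z = b := by
    rintro z (h | h) hz
    · exact absurd hz (hW z h)
    · exact h
  obtain ⟨p, hp⟩ := h.exists_walk_length_eq_dist
  have hpath := p.isPath_of_length_eq_dist hp
  have hlen : 2 ≤ p.length := hp ▸ h.one_lt_dist_of_ne_of_not_adj hab fun h' => hnadj h'.1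
  have hsupp : ∀ z ∈ p.support, z ∈ S := mem_of_mem_support_restrictEdges p haS
  let q : G.Walk a b := p.mapLe (restrictEdges_le G S)
  have hq : q.IsPath := hpath.mapLe (restrictEdges_le G S)
  have hqs : q.support = p.support := SimpleGraph.Walk.support_mapLe_eq_support _ _
  have hqe : q.edges = p.edges := SimpleGraph.Walk.edges_mapLe_eq_edges _ _
  have hql : q.length = p.length := SimpleGraph.Walk.length_map _ _
  have hxq : x ∉ q.support := fun h' => hxS (hsupp x (hqs ▸ h'))
  let c : G.Walk x x := SimpleGraph.Walk.cons ha (q.concat hb.symm)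
  have hcyc : c.IsCycle := by
    rw [SimpleGraph.Walk.cons_isCycle_iff]
    refine ⟨hq.concat hxq hb.symm, ?_⟩
    rw [SimpleGraph.Walk.edges_concat, List.concat_eq_append, List.mem_append,
      List.mem_singleton]
    rintro (h' | h')
    · exact hxq (q.fst_mem_support_of_mem_edges h')
    · rw [Sym2.eq_iff] at h'
      rcases h' with ⟨h', -⟩ | ⟨-, h'⟩
      · exact hb.ne h'
      · exact hab h'
  have hclen : 4 ≤ c.length := by
    simp only [c, SimpleGraph.Walk.length_cons, SimpleGraph.Walk.length_concat, hql]
    omega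
  have hcs : ∀ z, z ∈ c.support → z = x ∨ z ∈ p.support := by
    intro z hz
    simp only [c, SimpleGraph.Walk.support_cons, SimpleGraph.Walk.support_concat,
      List.mem_cons, List.mem_append, hqs, List.not_mem_nil, or_false] at hz
    tauto
  have hce : ∀ e, e = s(x, a) ∨ e ∈ p.edges ∨ e = s(b, x) → e ∈ c.edges := by
    intro e he
    simpa only [c, SimpleGraph.Walk.edges_cons, SimpleGraph.Walk.edges_concat,
      List.concat_eq_append, List.mem_cons, List.mem_append, hqe, List.not_mem_nil, or_false]
      using he
  have hstar : ∀ z ∈ p.support, G.Adj x z → s(x, z) ∈ c.edges := by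
    intro z hz hxz
    rcases hxadj z (hsupp z hz) hxz with rfl | rfl
    · exact hce _ (Or.inl rfl)
    · exact hce _ (Or.inr (Or.inr Sym2.eq_swap))
  obtain ⟨u, hu, v, hv, huv, hnot⟩ := hG x c hcyc hclen
  refine hnot ?_
  rcases hcs u hu with rfl | hu'
  · exact hstar v ((hcs v hv).resolve_left huv.ne') huv
  · rcases hcs v hv with rfl | hv'
    · rw [Sym2.eq_swap]
      exact hstar u hu' huv.symm
    · exact hce _ (Or.inr (Or.inl
        (mem_edges_of_length_eq_dist p hp hu' hv' ⟨huv, hsupp u hu', hsupp v hv'⟩)))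

/-- The neighbours of `v` within `T` are pairwise adjacent. -/
def IsSimplicialIn (G : SimpleGraph X) (T : Finset X) (v : X) : Prop :=
  ∀ a ∈ T, ∀ b ∈ T, G.Adj v a → G.Adj v b → a ≠ b → G.Adj a b

/-- Dirac's theorem: a vertex of an induced subgraph of a chordal graph that is not adjacent to
all others has a simplicial non-neighbour. -/
theorem IsChordal.exists_simplicial_not_adj {G : SimpleGraph X} (hG : IsChordal G)
    (T : Finset X) : ∀ x ∈ T, ∀ y ∈ T, x ≠ y → ¬ G.Adj x y →
      ∃ u ∈ T, u ≠ x ∧ ¬ G.Adj x u ∧ IsSimplicialIn G T u := by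
  classical
  induction T using Finset.strongInduction with
  | H T ih =>
    intro x hx y hy hxy hnadj
    -- `K` is the component of `y` among the non-neighbours of `x` in `T`, and `S` is its boundary.
    -- `S` consists of neighbours of `x` joined through `K`, hence is a clique.
    let W : Set X := {z | z ∈ T ∧ z ≠ x ∧ ¬ G.Adj x z}
    have hyW : y ∈ W := ⟨hy, hxy.symm, hnadj⟩
    let K : Set X := {z | (restrictEdges G W).Reachable y z}
    have hKW : ∀ z ∈ K, z ∈ W := fun z hz => mem_of_reachable_restrictEdges hz hyW
    let S : Set X := {z | z ∈ T ∧ G.Adj x z ∧ ∃ k ∈ K, G.Adj k z}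
    have hnbr : ∀ k ∈ K, ∀ z ∈ T, G.Adj k z → z ∈ K ∨ z ∈ S := by
      intro k hk z hz hkz
      by_cases hxz : G.Adj x z
      · exact Or.inr ⟨hz, hxz, k, hk, hkz⟩
      · have hzx : z ≠ x := by
          rintro rfl
          exact (hKW k hk).2.2 hkz.symm
        have hadj : (restrictEdges G W).Adj k z := ⟨hkz, hKW k hk, hz, hzx, hxz⟩
        exact Or.inl (SimpleGraph.Reachable.trans hk hadj.reachable)
    have hSclique : ∀ a ∈ S, ∀ b ∈ S, a ≠ b → G.Adj a b := by
      rintro a ⟨-, hxa, k, hk, hka⟩ b ⟨-, hxb, l, hl, hlb⟩ hab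
      refine hG.adj_of_reachable (W := W) (fun h => h.2.1 rfl) (fun z hz => hz.2.2) hxa hxb hab ?_
      have hkl : (restrictEdges G W).Reachable k l := SimpleGraph.Reachable.trans hk.symm hl
      have h1 : (restrictEdges G (W ∪ {a, b})).Adj a k :=
        ⟨hka.symm, by simp, Or.inl (hKW k hk)⟩
      have h2 : (restrictEdges G (W ∪ {a, b})).Adj l b :=
        ⟨hlb, Or.inl (hKW l hl), by simp⟩
      exact (h1.reachable.trans (hkl.mono (restrictEdges_mono G Set.subset_union_left))).trans
        h2.reachable
    let T' : Finset X := T.filter fun z => z ∈ K ∨ z ∈ S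
    have hT' : ∀ z, z ∈ T' ↔ z ∈ K ∨ z ∈ S := fun z => by
      simp only [T', Finset.mem_filter, and_iff_right_iff_imp]
      rintro (h | h)
      · exact (hKW z h).1
      · exact h.1
    have hss : T' ⊂ T := by
      refine (Finset.filter_subset _ _).ssubset_of_ne fun h => ?_
      have hx' : x ∈ T' := by
        rwa [show T' = T from h]
      rcases (hT' x).1 hx' with h' | h'
      · exact (hKW x h').2.1 rfl
      · exact h'.2.1.ne rfl
    -- All neighbours in `T` of a vertex of `K` lie in `T'`, so being simplicial in `T'` suffices.
    -- `T'` omits `x`, which allows induction.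
    suffices h : ∃ u ∈ K, IsSimplicialIn G T' u by
      obtain ⟨u, huK, hu⟩ := h
      refine ⟨u, (hKW u huK).1, (hKW u huK).2.1, (hKW u huK).2.2, fun a ha b hb hua hub => ?_⟩
      exact hu a ((hT' a).2 (hnbr u huK a ha hua)) b ((hT' b).2 (hnbr u huK b hb hub)) hua hub
    have hyK : y ∈ K := SimpleGraph.Reachable.refl y
    -- A simplicial non-neighbour of some `s ∈ S` avoids the clique `S`, so it lies in `K`.
    by_cases hS : ∃ s ∈ S, ∃ t ∈ T', s ≠ t ∧ ¬ G.Adj s t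
    · obtain ⟨s, hs, t, ht, hst, hn⟩ := hS
      obtain ⟨u, hu, hus, hnu, hsimp⟩ := ih T' hss s ((hT' s).2 (Or.inr hs)) t ht hst hn
      refine ⟨u, ((hT' u).1 hu).resolve_right fun huS => ?_, hsimp⟩
      exact hnu (hSclique s hs u huS hus.symm)
    -- Now vertices of `S` are adjacent to everything else in `T'`, so a vertex with a non-neighbour
    -- must lie in `K`.
    · push Not at hS
      by_cases hclique : ∀ p ∈ T', ∀ q ∈ T', p ≠ q → G.Adj p q
      · exact ⟨y, hyK, fun a ha b hb _ _ hab => hclique a ha b hb hab⟩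
      · push Not at hclique
        obtain ⟨p, hp, q, hq, hpq, hn⟩ := hclique
        obtain ⟨u, hu, hup, hnu, hsimp⟩ := ih T' hss p hp q hq hpq hn
        refine ⟨u, ((hT' u).1 hu).resolve_right fun huS => ?_, hsimp⟩
        exact hnu (hS u huS p hp hup).symm

theorem IsChordal.exists_simplicial {G : SimpleGraph X} (hG : IsChordal G) {T : Finset X}
    (hT : T.Nonempty) : ∃ u ∈ T, IsSimplicialIn G T u := by
  by_cases hclique : ∀ p ∈ T, ∀ q ∈ T, p ≠ q → G.Adj p q
  · obtain ⟨y, hy⟩ := hT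
    exact ⟨y, hy, fun a ha b hb _ _ hab => hclique a ha b hb hab⟩
  · push Not at hclique
    obtain ⟨p, hp, q, hq, hpq, hn⟩ := hclique
    obtain ⟨u, hu, -, -, hsimp⟩ := hG.exists_simplicial_not_adj T p hp q hq hpq hn
    exact ⟨u, hu, hsimp⟩

end Chordal

/-! ### Elimination of simplicial vertices -/

/-! ### Schur complements at one diagonal entry. -/

section Pivot

variable {Y : Type*} {A : Matrix Y Y ℂ}

open scoped MatrixOrder in
-- In a factorization `A = cᴴ * c` the diagonal entry is the squared norm of column `y` of `c`.
theorem apply_eq_zero_of_diag_eq_zero [Fintype Y] (hA : A.PosSemidef) {y : Y} (hy : A y y = 0)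
    (p : Y) :
    A p y = 0 := by
  classical
  obtain ⟨c, hc⟩ : ∃ c : Matrix Y Y ℂ, A = cᴴ * c :=
    (CStarAlgebra.nonneg_iff_eq_star_mul_self).1 hA.nonneg
  have hcol : ∀ k, c k y = 0 := by
    rw [hc, Matrix.mul_apply, Finset.sum_eq_zero_iff_of_nonneg] at hy
    · intro k
      have := hy k (Finset.mem_univ k)
      rw [Matrix.conjTranspose_apply] at this
      simpa using this
    · intro k _
      exact star_mul_self_nonneg _
  rw [hc, Matrix.mul_apply]
  exact Finset.sum_eq_zero fun k _ => by rw [hcol, mul_zero]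

/-- The Schur complement of the diagonal entry at `y`, with the row and the column of `y`
replaced by zero. -/
def pivot (A : Matrix Y Y ℂ) (y : Y) : Matrix Y Y ℂ :=
  Matrix.of fun p q => A p q - (A y y)⁻¹ * (A p y * A y q)

theorem pivot_apply_right [Fintype Y] (hA : A.PosSemidef) (y p : Y) : pivot A y p y = 0 := by
  -- With `0⁻¹ = 0` the pivot is then `A` itself, whose column at `y` already vanishes.
  by_cases h : A y y = 0
  · simp [pivot, apply_eq_zero_of_diag_eq_zero hA h]
  · simp only [pivot, Matrix.of_apply]
    field_simp
    ring

theorem pivot_isHermitian (hA : A.PosSemidef) (y : Y) : (pivot A y).IsHermitian := by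
  ext1 p q
  simp only [pivot, Matrix.conjTranspose_apply, Matrix.of_apply, star_sub, star_mul', star_inv₀,
    hA.1.apply]
  ring

theorem pivot_apply_left [Fintype Y] (hA : A.PosSemidef) (y q : Y) : pivot A y y q = 0 := by
  rw [← (pivot_isHermitian hA y).apply, pivot_apply_right hA, star_zero]

/-- The pivot is the congruence `(1 - P)ᴴ * A * (1 - P)`: the right factor already produces it, and
the left one does nothing because row `y` has been cleared. -/
theorem pivot_posSemidef [Fintype Y] [DecidableEq Y] (hA : A.PosSemidef) (y : Y) :
    (pivot A y).PosSemidef := by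
  let P : Matrix Y Y ℂ := Matrix.of fun p q => if p = y then (A y y)⁻¹ * A y q else 0
  have h1 : A * (1 - P) = pivot A y := by
    rw [mul_sub, mul_one]
    ext p q
    simp [Matrix.mul_apply, P, pivot, mul_left_comm]
  have h2 : (1 - P)ᴴ * A * (1 - P) = pivot A y := by
    have h3 : Pᴴ * pivot A y = 0 := by
      ext p q
      simp [Matrix.mul_apply, P, Matrix.conjTranspose_apply, apply_ite star,
        pivot_apply_left hA]
    rw [mul_assoc, h1, Matrix.conjTranspose_sub, sub_mul, h3, Matrix.conjTranspose_one, one_mul,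
      sub_zero]
  rw [← h2]
  exact hA.conjTranspose_mul_mul_same _

theorem apply_eq_pivot_add (hA : A.PosSemidef) (y p q : Y) :
    A p q = pivot A y p q + (A y y)⁻¹ * (A p y * star (A q y)) := by
  rw [hA.1.apply]
  simp [pivot]

theorem inv_diag_nonneg (hA : A.PosSemidef) (y : Y) : 0 ≤ (A y y)⁻¹ := by
  obtain ⟨r, hr, h⟩ : ∃ r : ℝ, 0 ≤ r ∧ (r : ℂ) = A y y := by
    have := Complex.nonneg_iff.1 (hA.diag_nonneg (i := y))
    exact ⟨(A y y).re, this.1, Complex.ext rfl (by simpa using this.2)⟩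
  rw [← h, ← Complex.ofReal_inv]
  exact_mod_cast inv_nonneg.2 hr

end Pivot

/-! ### Nonnegativity by eliminating simplicial vertices. -/

section Elimination

variable {X : Type*} (R : ToleranceRelation X) {ι : Type*} [Fintype ι] [Fintype X]

/-- The form `(p, q) ↦ B p q` is nonnegative on the rank one matrices `w w*` for which the second
coordinates of the support of `w` are pairwise related. -/
def NonnegOnCliques (B : Matrix (ι × X) (ι × X) ℂ) : Prop :=
  ∀ w : ι × X → ℂ, (∀ p q, w p ≠ 0 → w q ≠ 0 → R.rel p.2 q.2) →
    0 ≤ ∑ p, ∑ q, B p q * (w p * star (w q))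

variable {R} [DecidableEq ι] [DecidableEq X]

theorem NonnegOnCliques.sum_nonneg_of_support {B : Matrix (ι × X) (ι × X) ℂ}
    (hB : NonnegOnCliques R B) (hR : IsChordal R.graph) (T : Finset X) :
    ∀ A : Matrix (ι × X) (ι × X) ℂ, A.PosSemidef → (∀ p q, ¬ R.rel p.2 q.2 → A p q = 0) →
      (∀ p q, p.2 ∉ T → A p q = 0) → 0 ≤ ∑ p, ∑ q, B p q * A p q := by
  induction T using Finset.strongInduction with
  | H T ih =>
    rcases T.eq_empty_or_nonempty with rfl | hT
    · intro A _ _ hA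
      simp [hA]
    obtain ⟨v, hv, hsimp⟩ := hR.exists_simplicial hT
    -- Over the vertex `v` there is one index `(k, v)` for each `k`. They are eliminated one at a
    -- time, `s` holding those whose rows may still be nonzero; when `s` is empty, `v` leaves `T`.
    suffices h : ∀ (s : Finset ι) (A : Matrix (ι × X) (ι × X) ℂ), A.PosSemidef →
        (∀ p q, ¬ R.rel p.2 q.2 → A p q = 0) → (∀ p q, p.2 ∉ T → A p q = 0) →
        (∀ k ∉ s, ∀ q, A (k, v) q = 0) → 0 ≤ ∑ p, ∑ q, B p q * A p q from
      fun A hA hAR hAT => h Finset.univ A hA hAR hAT fun k hk => absurd (Finset.mem_univ k) hk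
    intro s
    induction s using Finset.induction_on with
    | empty =>
      intro A hA hAR hAT hs
      refine ih (T.erase v) (Finset.erase_ssubset hv) A hA hAR fun p q hp => ?_
      by_cases hpv : p.2 = v
      · rw [← Prod.mk.eta (p := p), hpv]
        exact hs p.1 (Finset.notMem_empty _) q
      · exact hAT p q fun h => hp (Finset.mem_erase.2 ⟨hpv, h⟩)
    | insert k s hk ihs =>
      intro A hA hAR hAT hs
      -- The support of column `(k, v)` lies over `v` and its neighbours in `T`, which form a clique
      -- because `v` is simplicial. Hence `hB` applies to the rank one part, and the pivot has no
      -- fill-in outside the relation.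
      have hclique : ∀ p q, A p (k, v) ≠ 0 → A q (k, v) ≠ 0 → R.rel p.2 q.2 := by
        intro p q hp hq
        by_cases hpq : p.2 = q.2
        · rw [hpq]
          exact R.refl _
        have hpv : R.rel p.2 v := not_not.1 fun h => hp (hAR p (k, v) h)
        have hqv : R.rel q.2 v := not_not.1 fun h => hq (hAR q (k, v) h)
        by_cases hpv' : p.2 = v
        · rw [hpv']
          exact R.symm _ _ hqv
        by_cases hqv' : q.2 = v
        · rw [hqv']
          exact hpv
        exact (hsimp p.2 (not_not.1 fun h => hp (hAT p _ h)) q.2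
          (not_not.1 fun h => hq (hAT q _ h)) ⟨Ne.symm hpv', R.symm _ _ hpv⟩
          ⟨Ne.symm hqv', R.symm _ _ hqv⟩ hpq).2
      have hdecomp : ∑ p, ∑ q, B p q * A p q = ∑ p, ∑ q, B p q * pivot A (k, v) p q
          + (A (k, v) (k, v))⁻¹ *
            ∑ p, ∑ q, B p q * (A p (k, v) * star (A q (k, v))) := by
        simp only [Finset.mul_sum, ← Finset.sum_add_distrib]
        refine Finset.sum_congr rfl fun p _ => Finset.sum_congr rfl fun q _ => ?_
        rw [apply_eq_pivot_add hA (k, v) p q]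
        ring
      have hpivot : ∀ p q, A p q = 0 → (A p (k, v) = 0 ∨ A q (k, v) = 0) →
          pivot A (k, v) p q = 0 := by
        intro p q h h'
        have := apply_eq_pivot_add hA (k, v) p q
        rcases h' with h' | h' <;> simpa [h, h'] using this.symm
      rw [hdecomp]
      refine add_nonneg (ihs _ (pivot_posSemidef hA _) ?_ ?_ ?_)
        (mul_nonneg (inv_diag_nonneg hA _) (hB _ hclique))
      · intro p q hpq
        refine hpivot p q (hAR p q hpq) ?_
        by_contra! h
        exact hpq (hclique p q h.1 h.2)
      · exact fun p q hp => hpivot p q (hAT p q hp) (Or.inl (hAT p _ hp))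
      · intro l hl q
        by_cases hlk : l = k
        · rw [hlk]
          exact pivot_apply_left hA _ q
        · have hl' : l ∉ insert k s := by simp [hl, hlk]
          exact hpivot _ q (hs l hl' q) (Or.inl (hs l hl' _))

theorem NonnegOnCliques.sum_nonneg {B : Matrix (ι × X) (ι × X) ℂ} (hB : NonnegOnCliques R B)
    (hR : IsChordal R.graph) {A : Matrix (ι × X) (ι × X) ℂ} (hA : A.PosSemidef)
    (hAR : ∀ p q, ¬ R.rel p.2 q.2 → A p q = 0) : 0 ≤ ∑ p, ∑ q, B p q * A p q :=
  hB.sum_nonneg_of_support hR Finset.univ A hA hAR fun _ _ h => absurd (Finset.mem_univ _) h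

end Elimination

/-! ### The dual matrix order in coordinates -/

section Coordinates

variable {X : Type*} {R : ToleranceRelation X}

theorem isClique_graph_iff {C : Set X} :
    R.graph.IsClique C ↔ ∀ i ∈ C, ∀ j ∈ C, R.rel i j := by
  constructor
  · intro h i hi j hj
    by_cases hij : i = j
    · exact hij ▸ R.refl i
    · exact (h hi hj hij).2
  · exact fun h i hi j hj hij => ⟨hij, h i hi j hj⟩

/-- The block of a matrix over `ι × X` that belongs to a subset of `X`. -/
def cliqueBlock {ι : Type*} (B : Matrix (ι × X) (ι × X) ℂ) (C : Set X) :
    Matrix (ι × C) (ι × C) ℂ :=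
  B.submatrix (fun p => (p.1, (p.2 : X))) fun p => (p.1, (p.2 : X))

theorem exists_maxClique [Fintype X] {C : Set X} (hC : R.graph.IsClique C) :
    ∃ D : R.MaxClique, C ⊆ (D : Finset X) := by
  classical
  obtain ⟨D, hCD, hD⟩ := Finite.exists_le_maximal
    (p := fun D : Finset X => R.graph.IsClique (D : Set X)) (a := C.toFinset) (by simpa using hC)
  exact ⟨⟨D, hD⟩, fun x hx => hCD (by simpa using hx)⟩

theorem sum_prod_eq_sum_subtype {ι : Type*} [Fintype ι] [Fintype X] (C : Finset X)
    (f : ι × X → ℂ) (hf : ∀ p, p.2 ∉ C → f p = 0) :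
    ∑ p, f p = ∑ p : ι × (C : Set X), f (p.1, p.2) := by
  rw [Fintype.sum_prod_type, Fintype.sum_prod_type]
  refine Finset.sum_congr rfl fun k _ => ?_
  rw [← Finset.sum_subset (Finset.subset_univ C) fun x _ hx => hf (k, x) hx]
  exact (Finset.sum_coe_sort C fun x => f (k, x)).symm

/-! ### Clique blocks and nonnegativity on cliques. -/

section Blocks

variable {ι : Type*} [Fintype X] {B : Matrix (ι × X) (ι × X) ℂ}

theorem NonnegOnCliques.cliqueBlock_posSemidef [Fintype ι] (hB : NonnegOnCliques R B)
    (hherm : B.IsHermitian) {C : Set X} (hC : R.graph.IsClique C) :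
    (cliqueBlock B C).PosSemidef := by
  classical
  let D : Matrix (ι × X) (ι × X) ℂ :=
    Matrix.of fun p q => if p.2 ∈ C ∧ q.2 ∈ C then B p q else 0
  have hD : D.PosSemidef := by
    refine Matrix.PosSemidef.of_dotProduct_mulVec_nonneg ?_ fun v => ?_
    · ext1 p q
      simp only [D, Matrix.conjTranspose_apply, Matrix.of_apply, apply_ite star, hherm.apply,
        star_zero, and_comm]
    -- `NonnegOnCliques` conjugates the second factor and the quadratic form the first, so `v`
    -- enters conjugated, cut off outside `C`.
    · have h := hB (fun p => if p.2 ∈ C then star (v p) else 0) fun p q hp hq =>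
        isClique_graph_iff.1 hC _ (by_contra fun h => hp (if_neg h)) _
          (by_contra fun h => hq (if_neg h))
      refine h.trans_eq ?_
      simp only [dotProduct, Matrix.mulVec, Finset.mul_sum]
      refine Finset.sum_congr rfl fun p _ => Finset.sum_congr rfl fun q _ => ?_
      by_cases hp : p.2 ∈ C <;> by_cases hq : q.2 ∈ C <;>
        simp [D, hp, hq, mul_left_comm]
  have h := hD.submatrix fun p : ι × C => (p.1, (p.2 : X))
  convert h using 1
  ext p q
  simp [cliqueBlock, D]

/-- The support of `w` projects to a clique. Inside a maximal clique containing it, the sum is the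
quadratic form of one block. -/
theorem nonnegOnCliques_of_cliqueBlock [Fintype ι]
    (h : ∀ C : R.MaxClique, (cliqueBlock B ((C : Finset X) : Set X)).PosSemidef) :
    NonnegOnCliques R B := by
  intro w hw
  have hclique : R.graph.IsClique {i | ∃ p, p.2 = i ∧ w p ≠ 0} := by
    rw [isClique_graph_iff]
    rintro _ ⟨p, rfl, hp⟩ _ ⟨q, rfl, hq⟩
    exact hw p q hp hq
  obtain ⟨C, hC⟩ := exists_maxClique hclique
  have hw0 : ∀ p, p.2 ∉ (C : Finset X) → w p = 0 := fun p hp =>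
    by_contra fun h' => hp (hC ⟨p, rfl, h'⟩)
  have hpos := (h C).dotProduct_mulVec_nonneg fun p => star (w (p.1, p.2))
  refine hpos.trans_eq ?_
  rw [sum_prod_eq_sum_subtype C _ fun p hp => by simp [hw0 p hp]]
  simp only [dotProduct, Matrix.mulVec, Finset.mul_sum]
  refine Finset.sum_congr rfl fun p _ => ?_
  refine Eq.trans (Finset.sum_congr rfl fun q _ => ?_)
    (sum_prod_eq_sum_subtype C (fun q => B (p.1, p.2) q * (w (p.1, p.2) * star (w q)))
      fun q hq => by simp [hw0 q hq]).symm
  simp [cliqueBlock, mul_left_comm]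

/-- Every related pair lies in a common maximal clique, so its entries are seen by a hermitian
block; all other entries vanish. -/
theorem isHermitian_of_cliqueBlock (hB : ∀ p q, ¬ R.rel p.2 q.2 → B p q = 0)
    (h : ∀ C : R.MaxClique, (cliqueBlock B ((C : Finset X) : Set X)).PosSemidef) :
    B.IsHermitian := by
  refine Matrix.IsHermitian.ext fun p q => ?_
  by_cases hpq : R.rel p.2 q.2
  · have hclique : R.graph.IsClique {p.2, q.2} := by
      rw [isClique_graph_iff]
      rintro _ (rfl | rfl) _ (rfl | rfl)
      · exact R.refl _
      · exact hpq
      · exact R.symm _ _ hpq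
      · exact R.refl _
    obtain ⟨C, hC⟩ := exists_maxClique hclique
    exact (h C).1.apply (p.1, ⟨p.2, hC (by simp)⟩) (q.1, ⟨q.2, hC (by simp)⟩)
  · rw [hB p q hpq, hB q p fun h' => hpq (R.symm _ _ h'), star_zero]

end Blocks

/-! ### Coefficient matrices and the dual cone. -/

variable [Fintype X] [DecidableEq X] {n : ℕ}

/-- The matrix over `n × X` with entries `φ_kl(e_ij)`. -/
def coeffMatrix (φ : Matrix (Fin n) (Fin n) (Module.Dual ℂ R.system)) :
    Matrix (Fin n × X) (Fin n × X) ℂ :=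
  Matrix.comp _ _ _ _ _ (φ.map fun f => (R.dualEquiv f : Matrix X X ℂ))

theorem coeffMatrix_apply_eq_zero (φ : Matrix (Fin n) (Fin n) (Module.Dual ℂ R.system))
    (p q : Fin n × X) (h : ¬ R.rel p.2 q.2) : coeffMatrix φ p q = 0 :=
  (R.dualEquiv (φ p.1 q.1)).2 _ _ h

theorem dual_apply_eq_sum (f : Module.Dual ℂ R.system) (y : R.system) :
    f y = ∑ i, ∑ j, (R.dualEquiv f : Matrix X X ℂ) i j * (y : Matrix X X ℂ) i j := by
  conv_lhs => rw [← R.dualEquiv.symm_apply_apply f]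
  rfl

theorem matrixPairing_eq_sum (φ : Matrix (Fin n) (Fin n) (Module.Dual ℂ R.system))
    (x : Matrix (Fin n) (Fin n) R.system) :
    matrixPairing φ x = ∑ p, ∑ q, coeffMatrix φ p q *
      Matrix.comp _ _ _ _ _ (x.map fun e => (e : Matrix X X ℂ)) p q := by
  simp only [Fintype.sum_prod_type]
  change ∑ k, ∑ l, φ k l (x k l) = _
  simp only [dual_apply_eq_sum]
  exact Finset.sum_congr rfl fun k _ => Finset.sum_comm

/-- The involution exchanges the matrix units `e_ij` and `e_ji`. -/
theorem dualEquiv_star (f : Module.Dual ℂ R.system) :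
    R.dualEquiv (star f) = star (R.dualEquiv f) := by
  classical
  apply Subtype.ext
  ext i j
  have hstar : ∀ (i j : X) (h : R.rel i j), star (R.unit h) = R.unit (R.symm _ _ h) := by
    intro i j h
    apply Subtype.ext
    simp [ToleranceRelation.unit]
  by_cases h : R.rel i j
  · simp [ToleranceRelation.dualEquiv, h, R.symm _ _ h, hstar]
  · have h' : ¬ R.rel j i := fun h' => h (R.symm _ _ h')
    simp [ToleranceRelation.dualEquiv, h, h']

theorem isHermitian_coeffMatrix_iff {φ : Matrix (Fin n) (Fin n) (Module.Dual ℂ R.system)} :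
    (coeffMatrix φ).IsHermitian ↔ φ.IsHermitian := by
  have key : ∀ k l, star (φ l k) = φ k l ↔
      ∀ i j, star (coeffMatrix φ (l, j) (k, i)) = coeffMatrix φ (k, i) (l, j) := by
    intro k l
    rw [← R.dualEquiv.injective.eq_iff, dualEquiv_star, Subtype.ext_iff, ← Matrix.ext_iff]
    rfl
  constructor
  · exact fun h => Matrix.IsHermitian.ext fun k l => (key k l).2 fun i j => h.apply _ _
  · exact fun h => Matrix.IsHermitian.ext fun p q => (key p.1 q.1).1 (h.apply _ _) p.2 q.2

theorem nonnegOnCliques_of_mem_dualCone {φ : Matrix (Fin n) (Fin n) (Module.Dual ℂ R.system)}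
    (h : φ ∈ dualCone R.system n) : NonnegOnCliques R (coeffMatrix φ) := by
  intro w hw
  -- The test element is `w w*`; the clique condition on the support of `w` is what puts its entries
  -- into `E(R)`.
  let x : Matrix (Fin n) (Fin n) R.system := Matrix.of fun k l =>
    ⟨Matrix.of fun i j => w (k, i) * star (w (l, j)), fun i j hij => by
      by_contra h'
      have h' : w (k, i) * star (w (l, j)) ≠ 0 := h'
      exact hij (hw _ _ (left_ne_zero_of_mul h') (star_ne_zero.1 (right_ne_zero_of_mul h')))⟩
  have hx : x ∈ MatrixOrdered.cone (V := R.system) n :=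
    mem_starCone_matrix.2 (Matrix.posSemidef_vecMulVec_self_star w)
  have := h.2 x hx
  rwa [matrixPairing_eq_sum] at this

theorem mem_dualCone_of_nonnegOnCliques (hR : IsChordal R.graph)
    {φ : Matrix (Fin n) (Fin n) (Module.Dual ℂ R.system)} (hφ : φ.IsHermitian)
    (h : NonnegOnCliques R (coeffMatrix φ)) : φ ∈ dualCone R.system n := by
  refine ⟨hφ, fun x hx => ?_⟩
  rw [matrixPairing_eq_sum]
  exact h.sum_nonneg hR (mem_starCone_matrix.1 hx) fun p q hpq => (x p.1 q.1).2 _ _ hpq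

theorem cliqueBlock_posSemidef_of_mem_dualCone
    {φ : Matrix (Fin n) (Fin n) (Module.Dual ℂ R.system)} (h : φ ∈ dualCone R.system n)
    {C : Set X} (hC : R.graph.IsClique C) : (cliqueBlock (coeffMatrix φ) C).PosSemidef :=
  (nonnegOnCliques_of_mem_dualCone h).cliqueBlock_posSemidef (isHermitian_coeffMatrix_iff.2 h.1) hC

theorem mem_dualCone_of_cliqueBlock (hR : IsChordal R.graph)
    {φ : Matrix (Fin n) (Fin n) (Module.Dual ℂ R.system)}
    (h : ∀ C : R.MaxClique, (cliqueBlock (coeffMatrix φ) ((C : Finset X) : Set X)).PosSemidef) :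
    φ ∈ dualCone R.system n :=
  mem_dualCone_of_nonnegOnCliques hR
    (isHermitian_coeffMatrix_iff.1 (isHermitian_of_cliqueBlock (coeffMatrix_apply_eq_zero φ) h))
    (nonnegOnCliques_of_cliqueBlock h)

theorem map_Phi_mem_cone_iff {φ : Matrix (Fin n) (Fin n) (Module.Dual ℂ R.system)} :
    φ.map R.Phi ∈ MatrixOrdered.cone
        (V := ∀ C : R.MaxClique, Matrix (C : Finset X) (C : Finset X) ℂ) n ↔
      ∀ C : R.MaxClique, (cliqueBlock (coeffMatrix φ) ((C : Finset X) : Set X)).PosSemidef :=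
  mem_starCone_pi.trans (forall_congr' fun _ => mem_starCone_matrix)

theorem Phi_injective (R : ToleranceRelation X) : Function.Injective R.Phi := by
  rw [ToleranceRelation.Phi, LinearMap.coe_comp]
  refine Function.Injective.comp (fun x y hxy => ?_) R.dualEquiv.injective
  apply Subtype.ext
  ext i j
  by_cases h : R.rel i j
  · have hclique : R.graph.IsClique {i, j} := by
      rw [isClique_graph_iff]
      rintro _ (rfl | rfl) _ (rfl | rfl)
      · exact R.refl _
      · exact h
      · exact R.symm _ _ h
      · exact R.refl _
    obtain ⟨C, hC⟩ := exists_maxClique hclique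
    exact congrFun (congrFun (congrFun hxy C) ⟨i, hC (by simp)⟩) ⟨j, hC (by simp)⟩
  · rw [x.2 i j h, y.2 i j h]

theorem mem_posCone_dual_iff (hR : IsChordal R.graph) (f : Module.Dual ℂ R.system) :
    f ∈ posCone (Module.Dual ℂ R.system) ↔
      IsPartiallyPositive R.graph (R.dualEquiv f : Matrix X X ℂ) := by
  constructor
  · intro h C hC
    -- For `n = 1` the block over `Fin 1 × C` is the principal submatrix at `C` up to reindexing.
    exact (cliqueBlock_posSemidef_of_mem_dualCone h hC).submatrix fun i : C => ((0 : Fin 1), i)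
  · intro h
    exact mem_dualCone_of_cliqueBlock hR fun C => (h _ C.2.prop).submatrix Prod.snd

end Coordinates

end FiniteTolerance

end

theorem theorem3p2 {X : Type*} [Fintype X] [DecidableEq X]
    (R : FiniteTolerance.ToleranceRelation X)
    (hR : FiniteTolerance.IsChordal R.graph) :
    FiniteTolerance.IsCompleteOrderEmbedding R.Phi ∧
      R.dualEquiv '' FiniteTolerance.posCone (Module.Dual ℂ R.system) =
        {M : R.system | FiniteTolerance.IsPartiallyPositive R.graph (M : Matrix X X ℂ)} := by
  refine ⟨⟨FiniteTolerance.Phi_injective R, fun n φ hφ => ?_, fun n φ hφ => ?_⟩, ?_⟩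
  · exact FiniteTolerance.map_Phi_mem_cone_iff.2 fun C =>
      FiniteTolerance.cliqueBlock_posSemidef_of_mem_dualCone hφ C.2.prop
  · exact FiniteTolerance.mem_dualCone_of_cliqueBlock hR
      (FiniteTolerance.map_Phi_mem_cone_iff.1 hφ)
  · ext M
    constructor
    · rintro ⟨f, hf, rfl⟩
      exact (FiniteTolerance.mem_posCone_dual_iff hR f).1 hf
    · intro hM
      refine ⟨R.dualEquiv.symm M, (FiniteTolerance.mem_posCone_dual_iff hR _).2 ?_, by simp⟩
      rwa [R.dualEquiv.apply_symm_apply]
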